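/- Let $A$ be a finite-dimensional algebra over an algebraically closed field $k$; modules are finite-dimensional left $A$-modules. Let $(V_i)_{i\in I}$ be representatives of the isomorphism classes of indecomposable $A$-modules and let $G(A)$ be the free abelian group with free generators $[V_i]$. For a module $M\cong\bigoplus_i a_iV_i$ put $[M]=\sum_i a_i[V_i]$, and for a short exact sequence $E: 0\to B\to C\to D\to 0$ put $[[E]]=[B]+[D]-[C]\in G(A)$. Let $(-,-)_A: G(A)\times G(A)\to\mathbb Z$ be the bilinear form with $([V_i],[V_j])_A=\dim_k\operatorname{Hom}_A(V_i,V_j)$. If $V_j$ is projective, let $X_j=[V_j]-[\operatorname{rad}V_j]$; if $V_j$ is not projective, let $X_j=[[A(V_j)]]$, where $A(V_j)$ is an Auslander-Reiten sequence ending in $V_j$ (a non-split short exact sequence $0\to L\to M\xrightarrow{g} V_j\to 0$ with $L$ indecomposable such that every homomorphism $Y\to V_j$ which is not a split epimorphism factors through $g$). Such a sequence exists for every non-projective $V_j$ and its class depends only on $j$, so $X_j$ is well defined for all $j\in I$, and the following hold. (1) $([V_i],X_j)_A=\delta_{i,j}$ for all $i,j\in I$. The form $(-,-)_A$ is non-degenerate,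 that is, its left and right kernels are both zero. Moreover $([V_i],[[E]])_A\ge 0$ for all $i\in I$, and more generally $([V],[[E]])_A\ge 0$ for every module $V$, for every short exact sequence $E$. (2) If $Q: 0\to C\to B\to V_j\to 0$ is a non-split exact sequence with $[[Q]]\ne X_j$, then there is an $i\in I$ with $i\neq j$ and $([V_i],[[Q]])_A\ge 1$. -/

import Mathlib

universe u

/-- A finite-dimensional (left) module over the `k`-algebra `A`; the `k`-structure is the one
induced from `A`, as the scalar tower says. -/
structure FDMod (k : Type u) (A : Type u) [Field k] [Ring A] [Algebra k A] where
  carrier : Type u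
  [addCommGroup : AddCommGroup carrier]
  [moduleBase : Module k carrier]
  [module : Module A carrier]
  [tower : IsScalarTower k A carrier]
  [finite : FiniteDimensional k carrier]

namespace FDMod

variable {k : Type u} {A : Type u} [Field k] [Ring A] [Algebra k A]

instance : CoeSort (FDMod k A) (Type u) := ⟨FDMod.carrier⟩

attribute [instance] addCommGroup moduleBase module tower finite

/-- A submodule of a finite-dimensional module, as a finite-dimensional module. -/
def ofSubmodule (M : FDMod k A) (N : Submodule A M) : FDMod k A :=
  haveI : FiniteDimensional k N :=
    Module.Finite.of_injective (N.subtype.restrictScalars k) N.injective_subtype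
  { carrier := N }

/-- The radical of a module: the intersection of its maximal submodules. -/
def rad (M : FDMod k A) : FDMod k A := M.ofSubmodule (Module.jacobson A M)

/-- `M` is non-zero and not the direct sum of two non-zero submodules. -/
def IsIndecomposable (M : FDMod k A) : Prop :=
  Nontrivial M ∧ ∀ N N' : Submodule A M, IsCompl N N' → N = ⊥ ∨ N' = ⊥

end FDMod

section

variable (k : Type u) (A : Type u) [Field k] [Ring A] [Algebra k A]

/-- Isomorphism of indecomposable finite-dimensional `A`-modules. -/
instance indSetoid : Setoid {M : FDMod k A // M.IsIndecomposable} where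
  r M N := Nonempty (M.1 ≃ₗ[A] N.1)
  iseqv := ⟨fun _ => ⟨LinearEquiv.refl A _⟩, fun ⟨e⟩ => ⟨e.symm⟩, fun ⟨e⟩ ⟨f⟩ => ⟨e.trans f⟩⟩

/-- The index set: isomorphism classes of indecomposable finite-dimensional `A`-modules. -/
def Ind : Type (u + 1) := Quotient (indSetoid k A)

/-- The group `G(A)`: the free abelian group on the isomorphism classes of indecomposables. -/
abbrev GGroup : Type (u + 1) := Ind k A →₀ ℤ

variable {k A}

/-- The representative `V_i` of the isomorphism class `i`. -/
noncomputable def indRep (i : Ind k A) : FDMod k A := (Quotient.out i).1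

theorem indRep_isIndecomposable (i : Ind k A) : (indRep i).IsIndecomposable :=
  (Quotient.out i).2

/-- The free generator `[V_i]` of `G(A)`. -/
noncomputable def gen (i : Ind k A) : GGroup k A := Finsupp.single i 1

/-- A decomposition `M ≅ ⨁ₜ V_{s t}` into finitely many representatives of indecomposables. -/
structure Decomposition (M : FDMod k A) where
  ι : Type
  [fintype : Fintype ι]
  s : ι → Ind k A
  equiv : M ≃ₗ[A] (∀ t, indRep (s t))

attribute [instance] Decomposition.fintype

theorem Decomposition.exists_of_finrank (n : ℕ) :
    ∀ M : FDMod k A, Module.finrank k M = n → Nonempty (Decomposition M) := by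
  induction n using Nat.strong_induction_on with
  | _ n ih =>
    intro M hn
    by_cases hM : Nontrivial M
    · by_cases hI : M.IsIndecomposable
      · let i : Ind k A := Quotient.mk (indSetoid k A) ⟨M, hI⟩
        obtain ⟨e⟩ : Nonempty (indRep i ≃ₗ[A] M) :=
          Quotient.exact (s := indSetoid k A) (Quotient.out_eq i)
        exact ⟨⟨Unit, fun _ => i,
          e.symm.trans (LinearEquiv.funUnique Unit A (indRep i)).symm⟩⟩
      · have hex : ∃ N N' : Submodule A M, IsCompl N N' ∧ N ≠ ⊥ ∧ N' ≠ ⊥ := by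
          by_contra hcon
          refine hI ⟨hM, fun N N' hc => ?_⟩
          by_contra hne
          exact hcon ⟨N, N', hc, fun h => hne (Or.inl h), fun h => hne (Or.inr h)⟩
        obtain ⟨N, N', hc, hN, hN'⟩ := hex
        have hs : ∀ P Q : Submodule A M, IsCompl P Q → Q ≠ ⊥ →
            Module.finrank k (M.ofSubmodule P) < n := by
          intro P Q hPQ hQ
          rw [← hn]
          refine Submodule.finrank_lt (s := P.restrictScalars k) fun htop => hQ ?_
          have hP : P = ⊤ := by
            rw [← Submodule.restrictScalars_eq_top_iff k A M]; exact htop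
          have := hPQ.disjoint
          rw [hP] at this
          exact top_disjoint.mp this
        obtain ⟨D⟩ := ih _ (hs N N' hc hN') (M.ofSubmodule N) rfl
        obtain ⟨D'⟩ := ih _ (hs N' N hc.symm hN) (M.ofSubmodule N') rfl
        let e₁ : M ≃ₗ[A] (M.ofSubmodule N × M.ofSubmodule N') :=
          (Submodule.prodEquivOfIsCompl N N' hc).symm
        exact ⟨⟨D.ι ⊕ D'.ι, Sum.elim D.s D'.s,
          (e₁.trans (D.equiv.prodCongr D'.equiv)).trans
            (LinearEquiv.sumPiEquivProdPi A D.ι D'.ι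
              (fun t => indRep (Sum.elim D.s D'.s t))).symm⟩⟩
    · have := not_nontrivial_iff_subsingleton.mp hM
      exact ⟨⟨Empty, Empty.elim, 0, 0, fun _ => Subsingleton.elim _ _, fun _ => by
        funext t; exact t.elim⟩⟩

theorem Decomposition.nonempty (M : FDMod k A) : Nonempty (Decomposition M) :=
  Decomposition.exists_of_finrank _ M rfl

/-- The class `[M] = ∑ aᵢ [V_i]` of `M ≅ ⨁ aᵢ V_i`. The decomposition is chosen; the class does
not depend on the choice, by the Krull-Schmidt theorem. -/
noncomputable def cls (M : FDMod k A) : GGroup k A :=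
  let D := Classical.choice (Decomposition.nonempty M)
  ∑ t, gen (D.s t)

variable (k A) in
/-- The bilinear form on `G(A)` with `([V_i],[V_j]) = dim_k Hom_A(V_i, V_j)`. -/
noncomputable def homForm : GGroup k A →ₗ[ℤ] GGroup k A →ₗ[ℤ] ℤ :=
  Finsupp.linearCombination ℤ fun i =>
    Finsupp.linearCombination ℤ fun j => (Module.finrank k (indRep i →ₗ[A] indRep j) : ℤ)

/-- An exact sequence `0 → B → C → D → 0` of finite-dimensional `A`-modules. -/
structure SES (B C D : FDMod k A) where
  f : B →ₗ[A] C
  g : C →ₗ[A] D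
  injective : Function.Injective f
  exact : Function.Exact f g
  surjective : Function.Surjective g

/-- The homomorphism `g` is a split epimorphism. -/
def IsSplitEpimorphism {C D : FDMod k A} (g : C →ₗ[A] D) : Prop :=
  ∃ s : D →ₗ[A] C, g ∘ₗ s = LinearMap.id

namespace SES

variable {B C D : FDMod k A}

/-- The class `[[E]] = [B] + [D] - [C]`. -/
noncomputable def cls (_E : SES B C D) : GGroup k A := _root_.cls B + _root_.cls D - _root_.cls C

/-- The sequence splits. -/
def IsSplit (E : SES B C D) : Prop := IsSplitEpimorphism E.g

/-- Auslander-Reiten (almost split) sequence: non-split, with indecomposable end terms, and every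
homomorphism to the right end term that is not a split epimorphism factors through `g`. -/
def IsAuslanderReiten (E : SES B C D) : Prop :=
  ¬ E.IsSplit ∧ B.IsIndecomposable ∧ D.IsIndecomposable ∧
    ∀ (Y : FDMod k A) (h : Y →ₗ[A] D), ¬ IsSplitEpimorphism h → ∃ h' : Y →ₗ[A] C, E.g ∘ₗ h' = h

end SES

/-- `x` is the element attached to `V_j`: the class `[V_j] - [rad V_j]` if `V_j` is projective,
and the class of an Auslander-Reiten sequence ending in `V_j` otherwise. -/
def IsARClass (j : Ind k A) (x : GGroup k A) : Prop :=
  (Module.Projective A (indRep j) ∧ x = gen j - cls (indRep j).rad) ∨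
  (¬ Module.Projective A (indRep j) ∧
    ∃ (L M : FDMod k A) (E : SES L M (indRep j)), E.IsAuslanderReiten ∧ x = E.cls)

end

/-! For an exact sequence ending in a map `g : C → D`, left exactness of `Hom(V_i, -)` shows that
pairing `[V_i]` with its class gives `dim Hom(V_i, D)` minus the dimension of the space of maps that
factor through `g` (`SES.homForm_gen_cls`); so it is nonnegative. If `g` is right almost split with
target `V_j`, everything factors when `i ≠ j`, and exactly the non-invertible endomorphisms factor
when `i = j`. These have codimension one, because `End(V_j)` is local with residue field `k`. This
covers Auslander-Reiten sequences as well as the inclusion of the radical of a projective, and gives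
the Kronecker delta.

The left kernel vanishes because pairing with `X_j` reads off a coordinate. The right kernel
vanishes because incoming Hom dimensions determine the indecomposable summands
(`exists_retract_of_finrank_hom_eq`); this also makes `X_j` unique. For (2), if all pairings with `i
≠ j` vanish, then every non-invertible endomorphism of `V_j` factors through `g`
(`nonunits_le_range_homPost`), so the class pairs like `X_j` and equals it.

Existence of Auslander-Reiten sequences is Auslander's construction from a finite presentation and
the dual of `A`, followed by a choice of minimal dimension. -/

namespace FDMod

variable {k : Type u} {A : Type u} [Field k] [Ring A] [Algebra k A]

/-! ### Local endomorphism rings of indecomposable modules. -/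

instance instFiniteOverAlgebra (M : FDMod k A) : Module.Finite A M :=
  Module.Finite.of_restrictScalars_finite k A M

instance instIsNoetherian (M : FDMod k A) : IsNoetherian A M :=
  isNoetherian_of_tower k inferInstance

instance instIsArtinian (M : FDMod k A) : IsArtinian A M :=
  isArtinian_of_tower k inferInstance

/-- Fitting's lemma. -/
theorem IsIndecomposable.isNilpotent_of_not_isUnit {V : FDMod k A} (hV : V.IsIndecomposable)
    {f : Module.End A V} (hf : ¬ IsUnit f) : IsNilpotent f := by
  -- The bound `1 ≤ n` matters: injectivity of `f ^ 0` says nothing about `f`.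
  obtain ⟨n, hn, hn1⟩ := ((LinearMap.eventually_isCompl_ker_pow_range_pow f).and
    (Filter.eventually_ge_atTop 1)).exists
  rcases hV.2 _ _ hn with h | h
  · exfalso
    apply hf
    have hinj : Function.Injective (f ^ n) := LinearMap.ker_eq_bot.mp h
    have hfi : Function.Injective f := by
      obtain ⟨m, rfl⟩ : ∃ m, n = m + 1 := ⟨n - 1, by omega⟩
      rw [pow_succ, Module.End.coe_mul] at hinj
      exact hinj.of_comp
    rw [Module.End.isUnit_iff]
    exact IsArtinian.bijective_of_injective_endomorphism f hfi
  · exact ⟨n, LinearMap.range_eq_bot.mp h⟩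

/-- If `w = f + g` were a unit, then `w⁻¹ f` would be nilpotent by Fitting, so `w⁻¹ g = 1 - w⁻¹ f`
would be a unit. -/
theorem IsIndecomposable.not_isUnit_add {V : FDMod k A} (hV : V.IsIndecomposable)
    {f g : Module.End A V} (hf : ¬ IsUnit f) (hg : ¬ IsUnit g) : ¬ IsUnit (f + g) := by
  rintro ⟨w, hw⟩
  have h1 : ¬ IsUnit ((w⁻¹ : (Module.End A V)ˣ) * f : Module.End A V) := by
    rwa [Units.isUnit_units_mul]
  have h2 := (hV.isNilpotent_of_not_isUnit h1).isUnit_one_sub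
  have h3 : 1 - (w⁻¹ : (Module.End A V)ˣ) * f = ((w⁻¹ : (Module.End A V)ˣ) * g : Module.End A V) := by
    have : (w⁻¹ : (Module.End A V)ˣ) * (f + g) = (1 : Module.End A V) := by
      rw [← hw, Units.inv_mul]
    rw [← this, mul_add, add_sub_cancel_left]
  rw [h3, Units.isUnit_units_mul] at h2
  exact hg h2

theorem IsIndecomposable.not_isUnit_zero {V : FDMod k A} (hV : V.IsIndecomposable) :
    ¬ IsUnit (0 : Module.End A V) := by
  have := hV.1
  exact _root_.not_isUnit_zero

/-- The non-invertible endomorphisms of an indecomposable module. -/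
def IsIndecomposable.nonunits {V : FDMod k A} (hV : V.IsIndecomposable) :
    Submodule k (V →ₗ[A] V) where
  carrier := {f | ¬ IsUnit (f : Module.End A V)}
  zero_mem' := hV.not_isUnit_zero
  add_mem' := hV.not_isUnit_add
  smul_mem' c f hf := by
    rintro hcf
    rcases eq_or_ne c 0 with rfl | hc
    · rw [zero_smul] at hcf
      exact hV.not_isUnit_zero hcf
    · apply hf
      rw [Module.End.isUnit_iff] at hcf ⊢
      have h := (LinearEquiv.smulOfUnit (Units.mk0 c⁻¹ (inv_ne_zero hc)) :
        V ≃ₗ[k] V).bijective.comp hcf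
      have h2 : (⇑(LinearEquiv.smulOfUnit (Units.mk0 c⁻¹ (inv_ne_zero hc)) : V ≃ₗ[k] V) ∘
          ⇑(c • f)) = f := by
        funext x
        change c⁻¹ • (c • f x) = f x
        rw [smul_smul, inv_mul_cancel₀ hc, one_smul]
      rwa [h2] at h

theorem IsIndecomposable.mem_nonunits {V : FDMod k A} (hV : V.IsIndecomposable)
    {f : V →ₗ[A] V} : f ∈ hV.nonunits ↔ ¬ Function.Bijective f := by
  rw [← Module.End.isUnit_iff]; rfl

theorem IsIndecomposable.id_notMem_nonunits {V : FDMod k A} (hV : V.IsIndecomposable) :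
    LinearMap.id ∉ hV.nonunits := by
  rw [hV.mem_nonunits, not_not]
  exact Function.bijective_id

/-- Over an algebraically closed field `f` has an eigenvalue `c`, and `f - c` is not injective. -/
theorem IsIndecomposable.exists_sub_smul_id_mem_nonunits [IsAlgClosed k] {V : FDMod k A}
    (hV : V.IsIndecomposable) (f : V →ₗ[A] V) :
    ∃ c : k, f - c • LinearMap.id ∈ hV.nonunits := by
  have := hV.1
  obtain ⟨c, hc⟩ := Module.End.exists_eigenvalue (f.restrictScalars k : Module.End k V)
  refine ⟨c, ?_⟩
  rw [hV.mem_nonunits]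
  intro hb
  obtain ⟨v, hv⟩ := hc.exists_hasEigenvector
  apply hv.2
  apply hb.1
  have : f v = c • v := hv.apply_eq_smul
  simp [this]

/-- The scalars form a complement of the non-units. This codimension is the diagonal value of the
Kronecker delta. -/
theorem IsIndecomposable.finrank_nonunits_add_one [IsAlgClosed k] {V : FDMod k A}
    (hV : V.IsIndecomposable) :
    Module.finrank k hV.nonunits + 1 = Module.finrank k (V →ₗ[A] V) := by
  have hid : (LinearMap.id : V →ₗ[A] V) ≠ 0 := fun h =>
    hV.id_notMem_nonunits (h ▸ hV.nonunits.zero_mem)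
  have hc : IsCompl hV.nonunits (k ∙ (LinearMap.id : V →ₗ[A] V)) := by
    constructor
    · rw [Submodule.disjoint_span_singleton' hid]
      exact hV.id_notMem_nonunits
    · rw [codisjoint_iff, eq_top_iff]
      intro f _
      obtain ⟨c, hc⟩ := hV.exists_sub_smul_id_mem_nonunits f
      rw [Submodule.mem_sup]
      exact ⟨_, hc, _, Submodule.smul_mem _ c (Submodule.mem_span_singleton_self _), by simp⟩
  rw [← Submodule.finrank_add_eq_of_isCompl hc, finrank_span_singleton hid]

/-- A section `s` gives `V = ker f ⊕ im s`, and `im s` is nonzero because `W` is. -/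
theorem IsIndecomposable.bijective_of_isSplitEpimorphism {V W : FDMod k A}
    (hV : V.IsIndecomposable) (hW : W.IsIndecomposable) {f : V →ₗ[A] W}
    (hf : IsSplitEpimorphism f) : Function.Bijective f := by
  obtain ⟨s, hs⟩ := hf
  have hfs : ∀ w, f (s w) = w := fun w => LinearMap.congr_fun hs w
  have := hW.1
  have hc : IsCompl (LinearMap.ker f) (LinearMap.range s) := by
    constructor
    · rw [Submodule.disjoint_def]
      rintro _ hx ⟨w, rfl⟩
      rw [LinearMap.mem_ker, hfs] at hx
      rw [hx, map_zero]
    · rw [codisjoint_iff, eq_top_iff]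
      intro v _
      rw [Submodule.mem_sup]
      exact ⟨v - s (f v), by simp [hfs], s (f v), ⟨_, rfl⟩, by simp⟩
  refine ⟨?_, fun w => ⟨s w, hfs w⟩⟩
  rcases hV.2 _ _ hc with h | h
  · exact LinearMap.ker_eq_bot.mp h
  · exfalso
    obtain ⟨w, hw⟩ := exists_ne (0 : W)
    apply hw
    rw [← hfs w, LinearMap.range_eq_bot.mp h]
    simp

/-- If a sum of endomorphisms of an indecomposable module is the identity, one of them is
invertible. -/
theorem IsIndecomposable.exists_bijective_of_sum_eq_id {V : FDMod k A} (hV : V.IsIndecomposable)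
    {ι : Type*} [Fintype ι] (f : ι → V →ₗ[A] V) (h : ∑ t, f t = LinearMap.id) :
    ∃ t, Function.Bijective (f t) := by
  by_contra! hcon
  exact hV.id_notMem_nonunits (h ▸ Submodule.sum_mem _ fun t _ => hV.mem_nonunits.mpr (hcon t))

/-- An indecomposable retract of a finite product of indecomposable modules is isomorphic to one
of the factors. -/
theorem IsIndecomposable.exists_equiv_of_retract_pi {V : FDMod k A} (hV : V.IsIndecomposable)
    {ι : Type*} [Fintype ι] {W : ι → FDMod k A} (hW : ∀ t, (W t).IsIndecomposable)
    (a : V →ₗ[A] ∀ t, W t) (b : (∀ t, W t) →ₗ[A] V) (hba : b ∘ₗ a = LinearMap.id) :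
    ∃ t, Nonempty (W t ≃ₗ[A] V) := by
  classical
  -- The identity `b ∘ a` is the sum over `t` of its parts through `W t`; an invertible part makes
  -- `W t → V` a split epimorphism.
  obtain ⟨t, ht⟩ := hV.exists_bijective_of_sum_eq_id
    (fun t => (b ∘ₗ LinearMap.single A (fun t => W t) t) ∘ₗ (LinearMap.proj t ∘ₗ a)) (by
      rw [← hba]
      ext x
      simp only [LinearMap.sum_apply, LinearMap.comp_apply, ← map_sum]
      congr 1
      exact LinearMap.sum_single_apply _ (a x))
  let e := LinearEquiv.ofBijective _ ht
  have hs : IsSplitEpimorphism (b ∘ₗ LinearMap.single A (fun t => W t) t) :=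
    ⟨(LinearMap.proj t ∘ₗ a) ∘ₗ e.symm.toLinearMap, by
      rw [← LinearMap.comp_assoc]
      ext x
      exact e.apply_symm_apply x⟩
  exact ⟨t, ⟨LinearEquiv.ofBijective _ ((hW t).bijective_of_isSplitEpimorphism hV hs)⟩⟩

end FDMod

/-! ### Comparing the representatives `V_i`. -/

section

variable {k : Type u} {A : Type u} [Field k] [Ring A] [Algebra k A]

theorem indRep_injective {i j : Ind k A} (h : Nonempty (indRep i ≃ₗ[A] indRep j)) : i = j :=
  Quotient.out_equiv_out.mp h

theorem not_isSplitEpimorphism_indRep {i j : Ind k A} (hij : i ≠ j)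
    (f : indRep i →ₗ[A] indRep j) : ¬ IsSplitEpimorphism f := fun hf =>
  hij (indRep_injective ⟨LinearEquiv.ofBijective f
    ((indRep_isIndecomposable i).bijective_of_isSplitEpimorphism (indRep_isIndecomposable j) hf)⟩)

theorem FDMod.IsIndecomposable.isSplitEpimorphism_iff {V : FDMod k A} (hV : V.IsIndecomposable)
    (f : V →ₗ[A] V) : IsSplitEpimorphism f ↔ Function.Bijective f :=
  ⟨hV.bijective_of_isSplitEpimorphism hV, fun h => ⟨(LinearEquiv.ofBijective f h).symm.toLinearMap,
    by ext x; exact (LinearEquiv.ofBijective f h).apply_symm_apply x⟩⟩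

end

/-! ### Hom dimensions and the bilinear form. -/

section

variable {k : Type u} {A : Type u} [Field k] [Ring A] [Algebra k A]

/-- Composition with `g` on the left, as a map of `Hom` spaces. -/
def homPost (X : FDMod k A) {C D : FDMod k A} (g : C →ₗ[A] D) :
    (X →ₗ[A] C) →ₗ[k] (X →ₗ[A] D) where
  toFun f := g ∘ₗ f
  map_add' f f' := LinearMap.comp_add f f' g
  map_smul' c f := by
    ext x
    exact LinearMap.map_smul_of_tower g c (f x)

/-- Composition with `f` on the right, as a map of `Hom` spaces. -/
def homPre {X Y : FDMod k A} (f : X →ₗ[A] Y) (Z : FDMod k A) :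
    (Y →ₗ[A] Z) →ₗ[k] (X →ₗ[A] Z) where
  toFun g := g ∘ₗ f
  map_add' g g' := LinearMap.add_comp f g' g
  map_smul' _ _ := rfl

@[simp] theorem homPost_apply (X : FDMod k A) {C D : FDMod k A} (g : C →ₗ[A] D) (f : X →ₗ[A] C) :
    homPost X g f = g ∘ₗ f := rfl

@[simp] theorem homPre_apply {X Y : FDMod k A} (f : X →ₗ[A] Y) (Z : FDMod k A) (g : Y →ₗ[A] Z) :
    homPre f Z g = g ∘ₗ f := rfl

/-- A finite product of finite-dimensional modules. -/
def FDMod.pi {ι : Type} [Fintype ι] (W : ι → FDMod k A) : FDMod k A where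
  carrier := ∀ t, W t

/-- A quotient of a finite-dimensional module. -/
def FDMod.quotient (M : FDMod k A) (N : Submodule A M) : FDMod k A :=
  haveI : FiniteDimensional k (M ⧸ N) :=
    Module.Finite.of_surjective (N.mkQ.restrictScalars k) N.mkQ_surjective
  { carrier := M ⧸ N }

theorem finrank_hom_congr_right (X : FDMod k A) {M N : FDMod k A} (e : M ≃ₗ[A] N) :
    Module.finrank k (X →ₗ[A] M) = Module.finrank k (X →ₗ[A] N) :=
  LinearEquiv.finrank_eq (LinearEquiv.ofLinearMap (homPost X e.toLinearMap)
    (homPost X e.symm.toLinearMap) (by ext; simp) (by ext; simp))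

theorem finrank_hom_congr_left {X Y : FDMod k A} (e : X ≃ₗ[A] Y) (M : FDMod k A) :
    Module.finrank k (X →ₗ[A] M) = Module.finrank k (Y →ₗ[A] M) :=
  (LinearEquiv.congrLeft M k e).finrank_eq

theorem finrank_hom_pi_right (X : FDMod k A) {ι : Type} [Fintype ι] (W : ι → FDMod k A) :
    Module.finrank k (X →ₗ[A] FDMod.pi W) = ∑ t, Module.finrank k (X →ₗ[A] W t) := by
  rw [← Module.finrank_pi_fintype]
  let e : (X →ₗ[A] FDMod.pi W) ≃ₗ[k] ∀ t, X →ₗ[A] W t :=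
    { toFun := fun f t => (LinearMap.proj t : (∀ t, W t) →ₗ[A] W t) ∘ₗ f
      invFun := fun f => (LinearMap.pi f : X →ₗ[A] ∀ t, W t)
      map_add' := fun f g => rfl
      map_smul' := fun c f => rfl
      left_inv := fun f => rfl
      right_inv := fun f => rfl }
  exact e.finrank_eq

theorem finrank_hom_pi_left {ι : Type} [Fintype ι] (W : ι → FDMod k A) (M : FDMod k A) :
    Module.finrank k (FDMod.pi W →ₗ[A] M) = ∑ t, Module.finrank k (W t →ₗ[A] M) := by
  classical
  rw [← Module.finrank_pi_fintype]
  exact (LinearMap.lsum A (fun t => W t) k (M := M)).symm.finrank_eq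

theorem finrank_hom_eq_sum_right (X : FDMod k A) {M : FDMod k A} (D : Decomposition M) :
    Module.finrank k (X →ₗ[A] M) = ∑ t, Module.finrank k (X →ₗ[A] indRep (D.s t)) := by
  rw [← finrank_hom_pi_right]
  exact finrank_hom_congr_right X (N := FDMod.pi fun t => indRep (D.s t)) D.equiv

theorem finrank_hom_eq_sum_left {X : FDMod k A} (D : Decomposition X) (M : FDMod k A) :
    Module.finrank k (X →ₗ[A] M) = ∑ t, Module.finrank k (indRep (D.s t) →ₗ[A] M) := by
  rw [← finrank_hom_pi_left]
  exact finrank_hom_congr_left (Y := FDMod.pi fun t => indRep (D.s t)) D.equiv M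

theorem homForm_gen_gen (i j : Ind k A) :
    homForm k A (gen i) (gen j) = (Module.finrank k (indRep i →ₗ[A] indRep j) : ℤ) := by
  simp [homForm, gen]

theorem homForm_gen_cls (i : Ind k A) (M : FDMod k A) :
    homForm k A (gen i) (cls M) = (Module.finrank k (indRep i →ₗ[A] M) : ℤ) := by
  rw [cls, map_sum, finrank_hom_eq_sum_right (indRep i) (Classical.choice (Decomposition.nonempty M)),
    Nat.cast_sum]
  exact Finset.sum_congr rfl fun t _ => homForm_gen_gen _ _

theorem SES.ker_homPost {B C D : FDMod k A} (E : SES B C D) (X : FDMod k A) :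
    LinearMap.ker (homPost X E.g) = LinearMap.range (homPost X E.f) := by
  ext φ
  constructor
  · intro h
    have h0 : ∀ x, φ x ∈ LinearMap.range E.f := fun x =>
      (E.exact (φ x)).mp (LinearMap.congr_fun (LinearMap.mem_ker.mp h) x)
    refine ⟨(LinearEquiv.ofInjective E.f E.injective).symm.toLinearMap ∘ₗ φ.codRestrict _ h0, ?_⟩
    ext x
    exact congrArg Subtype.val
      ((LinearEquiv.ofInjective E.f E.injective).apply_symm_apply ⟨φ x, h0 x⟩)
  · rintro ⟨ψ, rfl⟩
    rw [LinearMap.mem_ker]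
    ext x
    exact E.exact.apply_apply_eq_zero (ψ x)

/-- Rank-nullity for composition with `E.g`, whose kernel is a copy of `Hom(X, B)`. -/
theorem SES.finrank_hom (X : FDMod k A) {B C D : FDMod k A} (E : SES B C D) :
    Module.finrank k (LinearMap.range (homPost X E.g)) + Module.finrank k (X →ₗ[A] B) =
      Module.finrank k (X →ₗ[A] C) := by
  rw [← LinearMap.finrank_range_add_finrank_ker (homPost X E.g), E.ker_homPost X,
    LinearMap.finrank_range_of_inj (f := homPost X E.f)]
  intro φ ψ h
  ext x
  exact E.injective (LinearMap.congr_fun h x)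

/-- The pairing with the class of an exact sequence is the dimension of the space of homomorphisms
modulo those that factor. -/
theorem SES.homForm_gen_cls {B C D : FDMod k A} (E : SES B C D) (i : Ind k A) :
    homForm k A (gen i) E.cls = (Module.finrank k (indRep i →ₗ[A] D) : ℤ) -
      Module.finrank k (LinearMap.range (homPost (indRep i) E.g)) := by
  rw [SES.cls, map_sub, map_add, _root_.homForm_gen_cls, _root_.homForm_gen_cls,
    _root_.homForm_gen_cls, ← E.finrank_hom]
  push_cast
  ring

theorem SES.homForm_gen_cls_nonneg {B C D : FDMod k A} (E : SES B C D) (i : Ind k A) :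
    0 ≤ homForm k A (gen i) E.cls := by
  rw [E.homForm_gen_cls, sub_nonneg, Nat.cast_le]
  exact Submodule.finrank_le _

theorem SES.homForm_cls_cls_nonneg {B C D : FDMod k A} (E : SES B C D) (V : FDMod k A) :
    0 ≤ homForm k A (_root_.cls V) E.cls := by
  rw [_root_.cls.eq_def, map_sum, LinearMap.sum_apply]
  exact Finset.sum_nonneg fun t _ => E.homForm_gen_cls_nonneg _

/-! ### Hom dimensions determine classes -/

/-- The kernel of precomposition is `Hom(coker f, Z)`. The rank is thus expressed by dimensions of
`Hom(Y, Z)` and `Hom(coker f, Z)`, which lets two modules `Z` be compared. -/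
theorem finrank_range_homPre {M Y : FDMod k A} (f : M →ₗ[A] Y) (Z : FDMod k A) :
    Module.finrank k (LinearMap.range (homPre f Z)) +
      Module.finrank k (Y.quotient (LinearMap.range f) →ₗ[A] Z) =
      Module.finrank k (Y →ₗ[A] Z) := by
  let q : Y →ₗ[A] Y.quotient (LinearMap.range f) := (LinearMap.range f).mkQ
  have hq : Function.Surjective q := (LinearMap.range f).mkQ_surjective
  have hker : LinearMap.ker (homPre f Z) = LinearMap.range (homPre q Z) := by
    ext φ
    constructor
    · intro h
      have hle : LinearMap.range f ≤ LinearMap.ker φ := by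
        rintro _ ⟨x, rfl⟩
        exact LinearMap.congr_fun (LinearMap.mem_ker.mp h) x
      exact ⟨(LinearMap.range f).liftQ φ hle, (LinearMap.range f).liftQ_mkQ φ hle⟩
    · rintro ⟨ψ, rfl⟩
      rw [LinearMap.mem_ker]
      ext x
      have : q (f x) = 0 := (Submodule.Quotient.mk_eq_zero _).mpr ⟨x, rfl⟩
      simp [this]
  rw [← LinearMap.finrank_range_add_finrank_ker (homPre f Z), hker,
    LinearMap.finrank_range_of_inj (f := homPre q Z)]
  intro φ ψ h
  exact LinearMap.cancel_right hq |>.mp h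

/-- A module whose incoming `Hom` dimensions agree with those of `N` is a retract of a power
of `N`. -/
theorem exists_retract_of_finrank_hom_eq {M N : FDMod k A}
    (h : ∀ X : FDMod k A, Module.finrank k (X →ₗ[A] M) = Module.finrank k (X →ₗ[A] N)) :
    ∃ (n : ℕ) (a : M →ₗ[A] (Fin n → N)) (b : (Fin n → N) →ₗ[A] M), b ∘ₗ a = LinearMap.id := by
  let β := Module.finBasis k (M →ₗ[A] N)
  refine ⟨_, LinearMap.pi β, ?_⟩
  let Y : FDMod k A := FDMod.pi fun _ : Fin (Module.finrank k (M →ₗ[A] N)) => N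
  let a : M →ₗ[A] Y := LinearMap.pi β
  -- Each basis map `M → N` is a coordinate of `a`, so every map `M → N` factors through `a`.
  have hN : LinearMap.range (homPre a N) = ⊤ := by
    rw [eq_top_iff, ← β.span_eq, Submodule.span_le]
    rintro _ ⟨l, rfl⟩
    exact ⟨(LinearMap.proj l : (Fin _ → N) →ₗ[A] N), rfl⟩
  -- By the rank formula and `h` at `M`, `Y` and `Y / im a`, surjectivity for target `N` carries
  -- over to target `M`; the identity of `M` then factors through `a`.
  have hM : LinearMap.range (homPre a M) = ⊤ := by
    apply Submodule.eq_top_of_finrank_eq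
    have h1 := finrank_range_homPre a M
    have h2 := finrank_range_homPre a N
    rw [hN, finrank_top] at h2
    have h3 := h M
    have h4 := h Y
    have h5 := h (Y.quotient (LinearMap.range a))
    omega
  obtain ⟨b, hb⟩ : LinearMap.id ∈ LinearMap.range (homPre a M) := hM ▸ Submodule.mem_top
  exact ⟨b, hb⟩

/-- `V_{s a}` is a summand of `M`, hence a retract of a power of `N`, hence isomorphic to one of the
indecomposable factors. -/
theorem exists_eq_of_sum_finrank_eq {ι κ : Type} [Fintype ι] [Fintype κ] (s : ι → Ind k A)
    (t : κ → Ind k A)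
    (h : ∀ i : Ind k A, ∑ a, Module.finrank k (indRep i →ₗ[A] indRep (s a)) =
      ∑ b, Module.finrank k (indRep i →ₗ[A] indRep (t b))) (a : ι) : ∃ b, s a = t b := by
  classical
  let M := FDMod.pi fun a => indRep (s a)
  let N := FDMod.pi fun b => indRep (t b)
  have hMN : ∀ X : FDMod k A, Module.finrank k (X →ₗ[A] M) = Module.finrank k (X →ₗ[A] N) := by
    intro X
    obtain ⟨D⟩ := Decomposition.nonempty X
    rw [finrank_hom_eq_sum_left D, finrank_hom_eq_sum_left D]
    refine Finset.sum_congr rfl fun l _ => ?_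
    rw [finrank_hom_pi_right, finrank_hom_pi_right, h]
  obtain ⟨n, f, g, hgf⟩ := exists_retract_of_finrank_hom_eq hMN
  let c : (Fin n → N) ≃ₗ[A] (∀ x : (_ : Fin n) × κ, indRep (t x.2)) :=
    (LinearEquiv.piCurry A fun (_ : Fin n) (b : κ) => (indRep (t b) : Type u)).symm
  let inc : indRep (s a) →ₗ[A] M := LinearMap.single A (fun a => (indRep (s a) : Type u)) a
  let pr : M →ₗ[A] indRep (s a) := LinearMap.proj a
  have hpi : ∀ y, pr (inc y) = y := fun y => Pi.single_eq_same (M := fun a => indRep (s a)) a y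
  obtain ⟨x, ⟨e⟩⟩ := (indRep_isIndecomposable (s a)).exists_equiv_of_retract_pi
    (W := fun x : (_ : Fin n) × κ => indRep (t x.2)) (fun x => indRep_isIndecomposable _)
    (c.toLinearMap ∘ₗ f ∘ₗ inc) ((pr ∘ₗ g) ∘ₗ c.symm.toLinearMap) (by
      ext y
      have := LinearMap.congr_fun hgf (inc y)
      simp only [LinearMap.comp_apply, LinearEquiv.coe_coe, LinearEquiv.symm_apply_apply] at this ⊢
      rw [this, LinearMap.id_apply, hpi, LinearMap.id_apply])
  exact ⟨x.2, (indRep_injective ⟨e⟩).symm⟩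

/-- Applied to the positive and negative parts of an element of `G(A)`; the support condition keeps
the two families disjoint. -/
theorem exists_eq_sum_gen (p : Ind k A →₀ ℕ) :
    ∃ (n : ℕ) (s : Fin n → Ind k A), (∀ a, p (s a) ≠ 0) ∧
      ∑ a, gen (s a) = p.mapRange (fun m : ℕ => (m : ℤ)) rfl := by
  induction p using Finsupp.induction_linear with
  | zero => exact ⟨0, Fin.elim0, fun a => a.elim0, by simp⟩
  | add p q hp hq =>
    obtain ⟨n, s, hs, hs'⟩ := hp
    obtain ⟨m, t, ht, ht'⟩ := hq
    refine ⟨n + m, Fin.append s t, fun a => ?_, ?_⟩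
    · refine Fin.addCases (fun a => ?_) (fun a => ?_) a
      · rw [Fin.append_left, Finsupp.add_apply]
        have := hs a
        omega
      · rw [Fin.append_right, Finsupp.add_apply]
        have := ht a
        omega
    · rw [Fin.sum_univ_add]
      simp only [Fin.append_left, Fin.append_right]
      rw [hs', ht', Finsupp.mapRange_add (by intro a b; push_cast; rfl)]
  | single i m =>
    rcases Nat.eq_zero_or_pos m with rfl | hm
    · exact ⟨0, Fin.elim0, fun a => a.elim0, by simp⟩
    · exact ⟨m, fun _ => i, fun a => by simp; omega, by simp [gen]⟩

/-- The positive and negative parts of `y` share no indecomposable, but equal Hom dimensions force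
each indecomposable of one to occur in the other; so both are empty. -/
theorem homForm_separatingRight : (homForm k A).SeparatingRight := by
  intro y hy
  obtain ⟨n, s, hs, hs'⟩ := exists_eq_sum_gen (y.mapRange Int.toNat rfl)
  obtain ⟨m, t, ht, ht'⟩ := exists_eq_sum_gen ((-y).mapRange Int.toNat rfl)
  have hyst : y = ∑ a, gen (s a) - ∑ b, gen (t b) := by
    rw [hs', ht']
    ext i
    simp
  have hsum : ∀ i : Ind k A, ∑ a, Module.finrank k (indRep i →ₗ[A] indRep (s a)) =
      ∑ b, Module.finrank k (indRep i →ₗ[A] indRep (t b)) := by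
    intro i
    have h := hy (gen i)
    rw [hyst, map_sub, map_sum, map_sum, sub_eq_zero] at h
    simp only [homForm_gen_gen] at h
    exact_mod_cast h
  have hne : ∀ a b, s a ≠ t b := by
    intro a b hab
    have h1 := hs a
    have h2 := ht b
    rw [← hab] at h2
    simp at h1 h2
    omega
  have hn : IsEmpty (Fin n) := ⟨fun a =>
    let ⟨b, hb⟩ := exists_eq_of_sum_finrank_eq s t hsum a; hne a b hb⟩
  have hm : IsEmpty (Fin m) := ⟨fun b =>
    let ⟨a, ha⟩ := exists_eq_of_sum_finrank_eq t s (fun i => (hsum i).symm) b; hne a b ha.symm⟩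
  rw [hyst]
  simp

theorem eq_of_homForm_gen_eq {x y : GGroup k A}
    (h : ∀ i, homForm k A (gen i) x = homForm k A (gen i) y) : x = y := by
  rw [← sub_eq_zero]
  apply homForm_separatingRight
  intro z
  induction z using Finsupp.induction_linear with
  | zero => simp
  | add p q hp hq => rw [map_add, LinearMap.add_apply, hp, hq, add_zero]
  | single i m =>
    have : (Finsupp.single i m : GGroup k A) = m • gen i := by simp [gen]
    rw [this, map_smul, LinearMap.smul_apply, map_sub, h, sub_self, smul_zero]

end

/-! ### Right almost split maps and the elements `X_j`. -/

section

variable {k : Type u} {A : Type u} [Field k] [Ring A] [Algebra k A]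

/-- `g` is right almost split: not a split epimorphism, and every homomorphism to its target which
is not a split epimorphism factors through it. -/
def IsRightAlmostSplit {C D : FDMod k A} (g : C →ₗ[A] D) : Prop :=
  ¬ IsSplitEpimorphism g ∧
    ∀ (Y : FDMod k A) (h : Y →ₗ[A] D), ¬ IsSplitEpimorphism h → ∃ h' : Y →ₗ[A] C, g ∘ₗ h' = h

theorem IsSplitEpimorphism.of_comp {C D Y : FDMod k A} {g : C →ₗ[A] D} {h : Y →ₗ[A] C}
    (hgh : IsSplitEpimorphism (g ∘ₗ h)) : IsSplitEpimorphism g := by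
  obtain ⟨s, hs⟩ := hgh
  exact ⟨h ∘ₗ s, hs⟩

theorem IsSplitEpimorphism.surjective {C D : FDMod k A} {g : C →ₗ[A] D}
    (hg : IsSplitEpimorphism g) : Function.Surjective g := by
  obtain ⟨s, hs⟩ := hg
  exact fun x => ⟨s x, LinearMap.congr_fun hs x⟩

theorem range_homPost_le_nonunits {C V : FDMod k A} (hV : V.IsIndecomposable) {g : C →ₗ[A] V}
    (hg : ¬ IsSplitEpimorphism g) : LinearMap.range (homPost V g) ≤ hV.nonunits := by
  rintro _ ⟨φ, rfl⟩
  rw [hV.mem_nonunits, ← hV.isSplitEpimorphism_iff]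
  exact fun h => hg h.of_comp

theorem IsRightAlmostSplit.finrank_hom_sub [IsAlgClosed k] [DecidableEq (Ind k A)] {C : FDMod k A}
    {j : Ind k A} {g : C →ₗ[A] indRep j} (hg : IsRightAlmostSplit g) (i : Ind k A) :
    (Module.finrank k (indRep i →ₗ[A] indRep j) : ℤ) -
      Module.finrank k (LinearMap.range (homPost (indRep i) g)) = if i = j then 1 else 0 := by
  have hj := indRep_isIndecomposable j
  split_ifs with hij
  · subst hij
    have : LinearMap.range (homPost (indRep i) g) = hj.nonunits := by
      refine le_antisymm (range_homPost_le_nonunits hj hg.1) fun f hf => ?_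
      rw [hj.mem_nonunits, ← hj.isSplitEpimorphism_iff] at hf
      exact hg.2 _ f hf
    rw [this, ← hj.finrank_nonunits_add_one]
    push_cast
    ring
  · have : LinearMap.range (homPost (indRep i) g) = ⊤ := eq_top_iff.mpr fun f _ =>
      hg.2 _ f (not_isSplitEpimorphism_indRep hij f)
    rw [this, finrank_top, sub_self]

/-! ### Indecomposable projective modules -/

/-- If `N` were not inside a maximal submodule `m`, then `N + m = V`, and projectivity would split
the identity into two endomorphisms with images in the proper submodules `N` and `m`. Both are
non-units, contradicting locality. -/
theorem FDMod.IsIndecomposable.le_jacobson {V : FDMod k A} (hV : V.IsIndecomposable)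
    [Module.Projective A V] {N : Submodule A V} (hN : N ≠ ⊤) : N ≤ Module.jacobson A V := by
  refine le_sInf fun m hm => ?_
  by_contra hNm
  have htop : N ⊔ m = ⊤ := hm.2 _ (right_lt_sup.mpr hNm)
  have hsurj : Function.Surjective (N.subtype.coprod m.subtype) := by
    rw [← LinearMap.range_eq_top, LinearMap.range_coprod, Submodule.range_subtype,
      Submodule.range_subtype, htop]
  obtain ⟨s, hs⟩ := Module.projective_lifting_property _ (LinearMap.id : V →ₗ[A] V) hsurj
  have key : ∀ (P : Submodule A V) (t : V →ₗ[A] P), P ≠ ⊤ → P.subtype ∘ₗ t ∈ hV.nonunits := by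
    intro P t hP
    rw [hV.mem_nonunits]
    refine fun hb => hP (eq_top_iff.mpr fun x _ => ?_)
    obtain ⟨y, rfl⟩ := hb.2 x
    exact (t y).2
  apply hV.id_notMem_nonunits
  have : (LinearMap.id : V →ₗ[A] V) = N.subtype ∘ₗ (LinearMap.fst A N m ∘ₗ s) +
      m.subtype ∘ₗ (LinearMap.snd A N m ∘ₗ s) := by
    rw [← hs]
    rfl
  rw [this]
  exact Submodule.add_mem _ (key N _ hN) (key m _ hm.1)

/-- The inclusion of the radical of a module. -/
def FDMod.radSubtype (V : FDMod k A) : V.rad →ₗ[A] V := (Module.jacobson A V).subtype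

/-- A map to a projective that is not a split epimorphism is not surjective, so its image lies in
the radical. -/
theorem FDMod.IsIndecomposable.isRightAlmostSplit_radSubtype {V : FDMod k A}
    (hV : V.IsIndecomposable) [Module.Projective A V] : IsRightAlmostSplit V.radSubtype := by
  constructor
  · intro h
    have := hV.1
    refine (Module.jacobson_lt_top A V).ne (eq_top_iff.mpr fun x _ => ?_)
    obtain ⟨y, rfl⟩ := h.surjective x
    exact y.2
  · intro Y h hh
    have hr : LinearMap.range h ≠ ⊤ := fun htop =>
      hh (Module.projective_lifting_property h LinearMap.id (LinearMap.range_eq_top.mp htop))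
    exact ⟨h.codRestrict _ fun y => hV.le_jacobson hr ⟨y, rfl⟩, rfl⟩

theorem homForm_gen_of_isARClass [IsAlgClosed k] [DecidableEq (Ind k A)] {j : Ind k A}
    {x : GGroup k A} (hx : IsARClass j x) (i : Ind k A) :
    homForm k A (gen i) x = if i = j then 1 else 0 := by
  rcases hx with ⟨hP, rfl⟩ | ⟨-, L, M, E, hE, rfl⟩
  · have hg := (indRep_isIndecomposable j).isRightAlmostSplit_radSubtype
    rw [map_sub, homForm_gen_gen, homForm_gen_cls, ← hg.finrank_hom_sub i,
      LinearMap.finrank_range_of_inj]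
    intro φ ψ h
    ext x
    exact Subtype.ext (LinearMap.congr_fun h x)
  · rw [E.homForm_gen_cls]
    exact IsRightAlmostSplit.finrank_hom_sub ⟨hE.1, hE.2.2.2⟩ i

theorem isARClass_unique [IsAlgClosed k] {j : Ind k A} {x y : GGroup k A} (hx : IsARClass j x)
    (hy : IsARClass j y) : x = y := by
  classical
  exact eq_of_homForm_gen_eq fun i => by
    rw [homForm_gen_of_isARClass hx, homForm_gen_of_isARClass hy]

/-- Pairing with `X_j` is the `j`-th coordinate function. -/
theorem homForm_separatingLeft [IsAlgClosed k]
    (hex : ∀ j : Ind k A, ∃ x, IsARClass j x) : (homForm k A).SeparatingLeft := by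
  classical
  intro x hx
  ext j
  obtain ⟨y, hy⟩ := hex j
  have h : (homForm k A).flip y = Finsupp.lapply j := by
    refine Finsupp.lhom_ext' fun i => LinearMap.ext_ring ?_
    have := homForm_gen_of_isARClass hy i
    simp only [LinearMap.comp_apply, LinearMap.flip_apply, Finsupp.lsingle_apply,
      Finsupp.lapply_apply]
    rw [Finsupp.single_apply]
    exact this
  have h' := LinearMap.congr_fun h x
  rw [LinearMap.flip_apply, hx] at h'
  exact h'.symm

/-! ### Non-split sequences -/

/-- If every homomorphism from `V_i`, `i ≠ j`, to `V_j` factors through `g`, then so does every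
non-invertible endomorphism of `V_j`. -/
theorem nonunits_le_range_homPost {j : Ind k A} {C : FDMod k A} (g : C →ₗ[A] indRep j)
    (h : ∀ i, i ≠ j → ∀ f : indRep i →ₗ[A] indRep j, ∃ f', g ∘ₗ f' = f) :
    (indRep_isIndecomposable j).nonunits ≤ LinearMap.range (homPost (indRep j) g) := by
  classical
  intro φ hφ
  rw [FDMod.IsIndecomposable.mem_nonunits] at hφ
  -- The image of `φ` has smaller dimension than `V_j`, so none of its indecomposable summands is
  -- `V_j`. Its inclusion therefore lifts through `g` summand by summand, and `φ` lifts with it.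
  let W : FDMod k A := (indRep j).ofSubmodule (LinearMap.range φ)
  let ι : W →ₗ[A] indRep j := (LinearMap.range φ).subtype
  have hlt : Module.finrank k W < Module.finrank k (indRep j) := by
    refine Submodule.finrank_lt (s := (LinearMap.range φ).restrictScalars k) fun htop => hφ ?_
    have : LinearMap.range φ = ⊤ := by
      rw [← Submodule.restrictScalars_eq_top_iff k A]
      exact htop
    exact IsNoetherian.bijective_of_surjective_endomorphism φ (LinearMap.range_eq_top.mp this)
  obtain ⟨D⟩ := Decomposition.nonempty W
  have hne : ∀ t, D.s t ≠ j := by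
    intro t ht
    have hle : Module.finrank k (indRep (D.s t)) ≤ Module.finrank k W := by
      refine LinearMap.finrank_le_finrank_of_injective (f := (D.equiv.symm.toLinearMap ∘ₗ
        LinearMap.single A (fun t => (indRep (D.s t) : Type u)) t).restrictScalars k) ?_
      exact D.equiv.symm.injective.comp 
        (LinearMap.ker_eq_bot.mp (LinearMap.ker_single A (fun t => (indRep (D.s t) : Type u)) t))
    rw [ht] at hle
    omega
  choose f' hf' using fun t => h (D.s t) (hne t)
    (ι ∘ₗ D.equiv.symm.toLinearMap ∘ₗ LinearMap.single A (fun t => (indRep (D.s t) : Type u)) t)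
  let l : W →ₗ[A] C := LinearMap.lsum A (fun t => (indRep (D.s t) : Type u)) ℕ f' ∘ₗ
    D.equiv.toLinearMap
  have hl : ∀ w, g (l w) = ι w := by
    intro w
    have h1 : g ∘ₗ LinearMap.lsum A (fun t => (indRep (D.s t) : Type u)) ℕ f' =
        ι ∘ₗ D.equiv.symm.toLinearMap := by
      refine LinearMap.pi_ext' fun t => ?_
      rw [LinearMap.comp_assoc, LinearMap.comp_assoc, ← hf' t]
      ext x
      exact congrArg g (LinearMap.lsum_piSingle A _ ℕ f' t x)
    have h2 := LinearMap.congr_fun h1 (D.equiv w)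
    exact h2.trans (congrArg ι (D.equiv.symm_apply_apply w))
  refine ⟨l ∘ₗ φ.rangeRestrict, ?_⟩
  ext x
  exact hl (φ.rangeRestrict x)

/-- If all pairings with `i ≠ j` vanish, the endomorphisms of `V_j` that factor through `Q.g` are
exactly the non-units: at most these since `Q` is non-split, at least these by
`nonunits_le_range_homPost`. Then `Q.cls` and `x` have the same pairings. -/
theorem SES.exists_homForm_gen_cls_pos [IsAlgClosed k] {j : Ind k A} {x : GGroup k A}
    (hx : IsARClass j x) {C B : FDMod k A} (Q : SES C B (indRep j)) (hQ : ¬ Q.IsSplit)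
    (hne : Q.cls ≠ x) : ∃ i, i ≠ j ∧ 1 ≤ homForm k A (gen i) Q.cls := by
  classical
  by_contra! hcon
  have h0 : ∀ i, i ≠ j → homForm k A (gen i) Q.cls = 0 := fun i hi =>
    le_antisymm (by have := hcon i hi; omega) (Q.homForm_gen_cls_nonneg i)
  have hfac : ∀ i, i ≠ j → ∀ f : indRep i →ₗ[A] indRep j, ∃ f', Q.g ∘ₗ f' = f := by
    intro i hi f
    have h1 := h0 i hi
    rw [Q.homForm_gen_cls, sub_eq_zero, Nat.cast_inj] at h1
    have h2 : LinearMap.range (homPost (indRep i) Q.g) = ⊤ :=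
      Submodule.eq_top_of_finrank_eq h1.symm
    exact LinearMap.range_eq_top.mp h2 f
  have hj := indRep_isIndecomposable j
  have hrange : LinearMap.range (homPost (indRep j) Q.g) = hj.nonunits :=
    le_antisymm (range_homPost_le_nonunits hj hQ) (nonunits_le_range_homPost Q.g hfac)
  refine hne (eq_of_homForm_gen_eq fun i => ?_)
  rw [homForm_gen_of_isARClass hx]
  split_ifs with hij
  · rw [hij, Q.homForm_gen_cls, hrange, ← hj.finrank_nonunits_add_one]
    push_cast
    ring
  · exact h0 i hij

end

/-! ### The dual of the regular module. -/

section

variable (k : Type u) (A : Type u) [Field k] [Ring A] [Algebra k A]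

/-- The `k`-dual of `A`, as a left `A`-module. -/
def RegularDual : Type u := A →ₗ[k] k

namespace RegularDual

instance : AddCommGroup (RegularDual k A) := inferInstanceAs (AddCommGroup (A →ₗ[k] k))

instance : Module k (RegularDual k A) := inferInstanceAs (Module k (A →ₗ[k] k))

instance [FiniteDimensional k A] : FiniteDimensional k (RegularDual k A) :=
  inferInstanceAs (FiniteDimensional k (A →ₗ[k] k))

variable {k A}

/-- Evaluation of a functional. -/
def eval (f : RegularDual k A) : A →ₗ[k] k := f

/-- A functional, as an element of the dual module. -/
def mk (f : A →ₗ[k] k) : RegularDual k A := f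

@[ext] theorem ext {f g : RegularDual k A} (h : ∀ a, f.eval a = g.eval a) : f = g :=
  LinearMap.ext h

@[simp] theorem eval_mk (f : A →ₗ[k] k) (a : A) : (mk f).eval a = f a := rfl

@[simp] theorem eval_add (f g : RegularDual k A) (a : A) :
    (f + g).eval a = f.eval a + g.eval a := rfl

@[simp] theorem eval_zero (a : A) : (0 : RegularDual k A).eval a = 0 := rfl

@[simp] theorem eval_smul_base (c : k) (f : RegularDual k A) (a : A) :
    (c • f).eval a = c • f.eval a := rfl

instance : SMul A (RegularDual k A) := ⟨fun a f => mk (f.eval ∘ₗ LinearMap.mulRight k a)⟩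

@[simp] theorem eval_smul (a : A) (f : RegularDual k A) (b : A) :
    (a • f).eval b = f.eval (b * a) := rfl

instance : Module A (RegularDual k A) where
  one_smul f := by ext; simp
  mul_smul a b f := by ext; simp [mul_assoc]
  smul_zero a := by ext; simp
  smul_add a f g := by ext; simp
  add_smul a b f := by ext; simp [mul_add]
  zero_smul f := by ext; simp

instance : IsScalarTower k A (RegularDual k A) where
  smul_assoc c a f := by ext; simp

/-- The correspondence `Hom_A(X, Hom_k(A, k)) = Hom_k(X, k)`. -/
def lift {X : Type u} [AddCommGroup X] [Module k X] [Module A X] [IsScalarTower k A X]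
    (ξ : X →ₗ[k] k) : X →ₗ[A] RegularDual k A where
  toFun x := mk (ξ ∘ₗ (LinearMap.toSpanSingleton A X x).restrictScalars k)
  map_add' x y := by ext; simp
  map_smul' a x := by ext; simp [mul_smul]

variable (k) in
/-- The map between powers of the dual module given by right multiplication with a matrix. -/
def matrixMap {ι κ : Type} [Fintype κ] (r : κ → ι → A) :
    (κ → RegularDual k A) →ₗ[A] (ι → RegularDual k A) where
  toFun y i := ∑ t, mk ((y t).eval ∘ₗ LinearMap.mulLeft k (r t i))
  map_add' y z := by
    ext i a
    simp only [Pi.add_apply, ← Finset.sum_add_distrib]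
    rfl
  map_smul' b y := by
    funext i
    simp only [Pi.smul_apply, RingHom.id_apply, Finset.smul_sum]
    refine Finset.sum_congr rfl fun t _ => ?_
    ext a
    simp [mul_assoc]

theorem eval_sum {κ : Type} [Fintype κ] (f : κ → RegularDual k A) (a : A) :
    (∑ t, f t).eval a = ∑ t, (f t).eval a :=
  LinearMap.sum_apply (σ₁₂ := RingHom.id k) Finset.univ f a

theorem eval_matrixMap {ι κ : Type} [Fintype κ] (r : κ → ι → A) (y : κ → RegularDual k A)
    (i : ι) (a : A) : (matrixMap k r y i).eval a = ∑ t, (y t).eval (r t i * a) :=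
  eval_sum _ a

end RegularDual

end

/-! ### Finite presentations and extension of functionals. -/

section

variable {k : Type u} {A : Type u} [Field k] [Ring A] [Algebra k A]

/-- A functional vanishing on the kernel of a linear map factors through it. -/
theorem exists_comp_eq_of_ker_le {V W : Type*} [AddCommGroup V] [Module k V] [AddCommGroup W]
    [Module k W] (f : V →ₗ[k] W) (η : V →ₗ[k] k) (h : ∀ x, f x = 0 → η x = 0) :
    ∃ ξ : W →ₗ[k] k, ∀ x, ξ (f x) = η x := by
  have : η ∈ LinearMap.range f.dualMap := by
    rw [LinearMap.range_dualMap_eq_dualAnnihilator_ker, Submodule.mem_dualAnnihilator]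
    exact h
  obtain ⟨ξ, hξ⟩ := this
  exact ⟨ξ, fun x => LinearMap.congr_fun hξ x⟩

/-- A finite presentation by generators `v i` and relations `r t`. -/
structure FinPresentation (V : FDMod k A) where
  ι : Type
  κ : Type
  [fintypeι : Fintype ι]
  [fintypeκ : Fintype κ]
  v : ι → V
  r : κ → ι → A
  relation : ∀ t, ∑ i, r t i • v i = 0
  exists_lift : ∀ (X : FDMod k A) (x : ι → X), (∀ t, ∑ i, r t i • x i = 0) →
    ∃ u : V →ₗ[A] X, ∀ i, u (v i) = x i
  span : Submodule.span A (Set.range v) = ⊤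

attribute [instance] FinPresentation.fintypeι FinPresentation.fintypeκ

theorem FinPresentation.nonempty [FiniteDimensional k A] (V : FDMod k A) :
    Nonempty (FinPresentation V) := by
  obtain ⟨m, v, hv⟩ := Module.Finite.exists_fin (R := A) (M := V)
  have : IsNoetherian A (Fin m → A) := isNoetherian_of_tower k inferInstance
  let π : (Fin m → A) →ₗ[A] V := Fintype.linearCombination A v
  have hπ : Function.Surjective π := by
    rw [← LinearMap.range_eq_top, Fintype.range_linearCombination, hv]
  obtain ⟨n, r, hr⟩ := Submodule.fg_iff_exists_fin_generating_family.mp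
    (IsNoetherian.noetherian (LinearMap.ker π))
  refine ⟨⟨Fin m, Fin n, v, r, fun t => ?_, fun X x hx => ?_, hv⟩⟩
  · have : r t ∈ LinearMap.ker π := hr ▸ Submodule.subset_span ⟨t, rfl⟩
    exact this
  · let ρ : (Fin m → A) →ₗ[A] X := Fintype.linearCombination A x
    have hle : LinearMap.ker π ≤ LinearMap.ker ρ := by
      rw [← hr, Submodule.span_le]
      rintro _ ⟨t, rfl⟩
      exact hx t
    obtain ⟨s, hs⟩ := hπ.hasRightInverse
    let e := π.quotKerEquivOfSurjective hπ
    refine ⟨(LinearMap.ker π).liftQ ρ hle ∘ₗ e.symm.toLinearMap, fun i => ?_⟩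
    have h1 : v i = e (Submodule.Quotient.mk (Pi.single i 1)) := by
      change v i = π (Pi.single i 1)
      simp [π]
    rw [h1]
    simp [ρ]

/-- The functional on the endomorphisms of an indecomposable module which sends the identity to `1`
and kills the non-invertible ones. -/
theorem FDMod.IsIndecomposable.exists_functional {V : FDMod k A} (hV : V.IsIndecomposable) :
    ∃ θ : (V →ₗ[A] V) →ₗ[k] k, θ LinearMap.id ≠ 0 ∧
      ∀ f : V →ₗ[A] V, ¬ Function.Bijective f → θ f = 0 := by
  obtain ⟨θ, h1, h2⟩ := Submodule.exists_le_ker_of_notMem hV.id_notMem_nonunits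
  exact ⟨θ, h1, fun f hf => h2 (hV.mem_nonunits.mpr hf)⟩

/-- The functional on `V ^ ι` extending `θ` along `f ↦ (f (v i))`. -/
theorem FinPresentation.exists_extend {V : FDMod k A} (P : FinPresentation V)
    (θ : (V →ₗ[A] V) →ₗ[k] k) :
    ∃ η : (P.ι → V) →ₗ[k] k, ∀ f : V →ₗ[A] V, η (fun i => f (P.v i)) = θ f := by
  let j : (V →ₗ[A] V) →ₗ[k] (P.ι → V) :=
    { toFun := fun f i => f (P.v i)
      map_add' := fun f g => rfl
      map_smul' := fun c f => rfl }
  obtain ⟨η, hη⟩ := exists_comp_eq_of_ker_le j θ (fun f hf => by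
    have : f = 0 := LinearMap.ext_on_range P.span fun i => congrFun hf i
    rw [this, map_zero])
  exact ⟨η, hη⟩

end

/-! ### Existence of Auslander-Reiten sequences. -/

section

variable {k : Type u} {A : Type u} [Field k] [Ring A] [Algebra k A]

/-- A homomorphism from a non-projective indecomposable module to itself which factors through the
regular module is not invertible. -/
theorem FDMod.not_bijective_of_factors {V : FDMod k A} (hP : ¬ Module.Projective A V)
    (u : V →ₗ[A] A) (v : V) :
    ¬ Function.Bijective (LinearMap.toSpanSingleton A V v ∘ₗ u) := by
  intro hb
  refine hP (Module.Projective.of_split u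
    ((LinearEquiv.ofBijective _ hb).symm.toLinearMap ∘ₗ LinearMap.toSpanSingleton A V v) ?_)
  ext x
  exact (LinearEquiv.ofBijective _ hb).symm_apply_apply x

/-- Auslander's construction: the pullback of `ν P₁ → ν P₀` along the map `V → ν P₀` that
corresponds to a functional on `Hom(P₀, V)`. -/
theorem FDMod.IsIndecomposable.exists_isRightAlmostSplit [FiniteDimensional k A] {V : FDMod k A}
    (hV : V.IsIndecomposable) (hP : ¬ Module.Projective A V) :
    ∃ (M : FDMod k A) (g : M →ₗ[A] V), Function.Surjective g ∧ IsRightAlmostSplit g := by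
  classical
  obtain ⟨P⟩ := FinPresentation.nonempty V
  obtain ⟨θ, hθ1, hθ⟩ := hV.exists_functional
  obtain ⟨η, hη⟩ := P.exists_extend θ
  let h : V →ₗ[A] (P.ι → RegularDual k A) :=
    LinearMap.pi fun i => RegularDual.lift (η ∘ₗ LinearMap.single k (fun _ => (V : Type u)) i)
  have hh : ∀ v i a, (h v i).eval a = η (Pi.single i (a • v)) := fun v i a => rfl
  have hηsum : ∀ x : P.ι → V, η x = ∑ i, η (Pi.single i (x i)) := fun x => by
    rw [← map_sum, Finset.univ_sum_single]
  let d := RegularDual.matrixMap k P.r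
  let T : FDMod k A := { carrier := V × (P.κ → RegularDual k A) }
  -- The pullback of `h` and `d`. A map `f : X → V` lifts to it exactly when `h ∘ f` factors through
  -- `d`.
  let N : Submodule A T :=
    LinearMap.ker (h ∘ₗ LinearMap.fst A V (P.κ → RegularDual k A) - d ∘ₗ LinearMap.snd A V _)
  have hN : ∀ v y, ((v, y) : V × (P.κ → RegularDual k A)) ∈ N ↔ h v = d y := fun v y => by
    rw [← sub_eq_zero]
    exact LinearMap.mem_ker
  let g : T.ofSubmodule N →ₗ[A] V := LinearMap.fst A V (P.κ → RegularDual k A) ∘ₗ N.subtype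
  refine ⟨T.ofSubmodule N, g, ?_, ?_, ?_⟩
  · intro v
    -- A preimage of `v` amounts to a functional `ξ` with `ξ ∘ ρ = η ∘ ev`. The kernel of `ρ` is
    -- `Hom(V, A)`, and there `η ∘ ev` takes the value of `θ` on an endomorphism factoring through
    -- `A`, which is zero as `V` is not projective.
    let ρ : (P.ι → A) →ₗ[k] (P.κ → A) :=
      { toFun := fun a t => ∑ i, P.r t i * a i
        map_add' := fun a b => by
          funext t
          simp [mul_add, Finset.sum_add_distrib]
        map_smul' := fun c a => by
          funext t
          simp [Finset.smul_sum] }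
    let ev : (P.ι → A) →ₗ[k] (P.ι → V) :=
      { toFun := fun a i => a i • v
        map_add' := fun a b => by
          funext i
          exact add_smul _ _ _
        map_smul' := fun c a => by
          funext i
          exact smul_assoc _ _ _ }
    obtain ⟨ξ, hξ⟩ := exists_comp_eq_of_ker_le ρ (η ∘ₗ ev) (by
      intro a ha
      obtain ⟨u, hu⟩ := P.exists_lift { carrier := A } a (fun t => congrFun ha t)
      have : ev a = fun i => (LinearMap.toSpanSingleton A V v ∘ₗ u) (P.v i) := by
        funext i
        exact congrArg (· • v) (hu i).symm
      rw [LinearMap.comp_apply, this, hη]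
      exact hθ _ (FDMod.not_bijective_of_factors hP u v))
    refine ⟨⟨(v, fun t => RegularDual.mk (ξ ∘ₗ LinearMap.single k (fun _ => A) t)), ?_⟩, rfl⟩
    rw [hN]
    ext i a
    rw [hh, RegularDual.eval_matrixMap]
    have h1 : ev (Pi.single i a) = Pi.single i (a • v) := by
      funext l
      rcases eq_or_ne l i with rfl | hl
      · simp [ev]
      · simp [ev, hl]
    have h2 : ρ (Pi.single i a) = ∑ t, Pi.single t (P.r t i * a) := by
      funext l
      rw [Finset.univ_sum_single (fun t => P.r t i * a)]
      simp [ρ, Pi.single_apply]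
    have h3 := hξ (Pi.single i a)
    rw [LinearMap.comp_apply, h1, h2, map_sum] at h3
    exact h3.symm
  · rintro ⟨s, hs⟩
    -- A section would give `h = d ∘ y`. Evaluating at the generators and at `1 : A` writes `θ id`
    -- as a sum over the relations, each term of which vanishes.
    let y : V →ₗ[A] (P.κ → RegularDual k A) := LinearMap.snd A V _ ∘ₗ N.subtype ∘ₗ s
    have hy : ∀ v, h v = d (y v) := fun v => by
      have h1 : (N.subtype (s v)).1 = v := LinearMap.congr_fun hs v
      have h2 : h (N.subtype (s v)).1 = d (y v) := (hN _ _).mp (s v).2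
      rwa [h1] at h2
    apply hθ1
    rw [← hη, hηsum]
    have h3 : ∀ i, η (Pi.single i (LinearMap.id (R := A) (P.v i))) =
        ∑ t, (P.r t i • y (P.v i) t).eval 1 := by
      intro i
      have h4 := hh (P.v i) i 1
      rw [one_smul, hy, RegularDual.eval_matrixMap] at h4
      simpa using h4.symm
    simp only [h3]
    rw [Finset.sum_comm]
    refine Finset.sum_eq_zero fun t _ => ?_
    rw [← RegularDual.eval_sum]
    have h5 : ∑ i, P.r t i • y (P.v i) t = 0 := by
      have h6 := congrArg (fun x => y x t) (P.relation t)
      simpa using h6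
    rw [h5, RegularDual.eval_zero]
  · intro X f hf
    -- Now the kernel of `ρ` is `Hom(V, X)`, and `η ∘ F` sends `u` to `θ (f ∘ u)`, which is zero
    -- because an invertible `f ∘ u` would split `f`. The resulting `ξ` corresponds to the second
    -- component `y` of the lift.
    let ρ : (P.ι → X) →ₗ[k] (P.κ → X) :=
      { toFun := fun x t => ∑ i, P.r t i • x i
        map_add' := fun a b => by
          funext t
          simp [Finset.sum_add_distrib]
        map_smul' := fun c a => by
          funext t
          simp only [Pi.smul_apply, RingHom.id_apply, Finset.smul_sum]
          exact Finset.sum_congr rfl fun i _ => smul_comm _ _ _ }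
    let F : (P.ι → X) →ₗ[k] (P.ι → V) := LinearMap.compLeft (f.restrictScalars k) P.ι
    obtain ⟨ξ, hξ⟩ := exists_comp_eq_of_ker_le ρ (η ∘ₗ F) (by
      intro x hx
      obtain ⟨u, hu⟩ := P.exists_lift X x (fun t => congrFun hx t)
      have : F x = fun i => (f ∘ₗ u) (P.v i) := by
        funext i
        exact congrArg f (hu i).symm
      rw [LinearMap.comp_apply, this, hη]
      refine hθ _ fun hb => hf ?_
      rw [← hV.isSplitEpimorphism_iff] at hb
      exact hb.of_comp)
    let y : X →ₗ[A] (P.κ → RegularDual k A) :=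
      LinearMap.pi fun t => RegularDual.lift (ξ ∘ₗ LinearMap.single k (fun _ => (X : Type u)) t)
    refine ⟨(f.prod y).codRestrict N fun x => ?_, rfl⟩
    change (f x, y x) ∈ N
    rw [hN]
    ext i a
    rw [hh, RegularDual.eval_matrixMap]
    have h1 : F (Pi.single i (a • x)) = Pi.single i (a • f x) := by
      funext l
      rcases eq_or_ne l i with rfl | hl
      · simp [F]
      · simp [F, hl]
    have h2 : ρ (Pi.single i (a • x)) = ∑ t, Pi.single t ((P.r t i * a) • x) := by
      rw [Finset.univ_sum_single (fun t => (P.r t i * a) • x)]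
      funext l
      change ∑ i', P.r l i' • (Pi.single i (a • x) : P.ι → X) i' = _
      rw [Finset.sum_eq_single i (fun b _ hb => by rw [Pi.single_eq_of_ne hb, smul_zero])
        (fun hi => absurd (Finset.mem_univ i) hi), Pi.single_eq_same, smul_smul]
    have h3 := hξ (Pi.single i (a • x))
    rw [LinearMap.comp_apply, h1, h2, map_sum] at h3
    exact h3.symm

/-- The kernel sequence of a surjective homomorphism. -/
def SES.ofSurjective {M V : FDMod k A} (g : M →ₗ[A] V) (hg : Function.Surjective g) :
    SES (M.ofSubmodule (LinearMap.ker g)) M V where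
  f := (LinearMap.ker g).subtype
  g := g
  injective := (LinearMap.ker g).injective_subtype
  exact := LinearMap.exact_subtype_ker_map g
  surjective := hg

/-- The homomorphism induced on the quotient by a submodule of the kernel. -/
def FDMod.quotientLift {M V : FDMod k A} (g : M →ₗ[A] V) (N : Submodule A M)
    (hN : N ≤ LinearMap.ker g) : M.quotient N →ₗ[A] V :=
  N.liftQ g hN

/-- The quotient map. -/
def FDMod.mkQ (M : FDMod k A) (N : Submodule A M) : M →ₗ[A] M.quotient N := Submodule.mkQ N

theorem FDMod.mkQ_eq_zero {M : FDMod k A} {N : Submodule A M} {x : M} :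
    M.mkQ N x = 0 ↔ x ∈ N := Submodule.Quotient.mk_eq_zero N

theorem FDMod.mkQ_surjective (M : FDMod k A) (N : Submodule A M) :
    Function.Surjective (M.mkQ N) := Submodule.mkQ_surjective N

theorem FDMod.quotientLift_mkQ {M V : FDMod k A} (g : M →ₗ[A] V) (N : Submodule A M)
    (hN : N ≤ LinearMap.ker g) (x : M) : FDMod.quotientLift g N hN (M.mkQ N x) = g x := rfl

theorem FDMod.eq_bot_of_finrank_le_quotient {M : FDMod k A} {N : Submodule A M}
    (h : Module.finrank k M ≤ Module.finrank k (M.quotient N)) : N = ⊥ := by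
  have hs : Function.Surjective ((M.mkQ N).restrictScalars k) := M.mkQ_surjective N
  have heq := le_antisymm h (LinearMap.finrank_le_finrank_of_surjective hs)
  have hinj := (LinearMap.injective_iff_surjective_of_finrank_eq_finrank heq).mpr hs
  rw [eq_bot_iff]
  intro x hx
  exact hinj ((FDMod.mkQ_eq_zero.mpr hx).trans (map_zero _).symm)

/-- If the kernel of `g` is the direct sum of `N` and `N'` and both induced homomorphisms on
`M / N` and `M / N'` are split epimorphisms, then so is `g`. -/
theorem isSplitEpimorphism_of_quotients {M V : FDMod k A} {g : M →ₗ[A] V} {N N' : Submodule A M}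
    (hdisj : Disjoint N N') (hsup : N ⊔ N' = LinearMap.ker g)
    (h : IsSplitEpimorphism (FDMod.quotientLift g N (hsup ▸ le_sup_left)))
    (h' : IsSplitEpimorphism (FDMod.quotientLift g N' (hsup ▸ le_sup_right))) :
    IsSplitEpimorphism g := by
  obtain ⟨s, hs⟩ := h
  obtain ⟨s', hs'⟩ := h'
  let φ : M →ₗ[A] M.quotient N × M.quotient N' := (M.mkQ N).prod (M.mkQ N')
  have hφ : Function.Injective φ := by
    rw [← LinearMap.ker_eq_bot, LinearMap.ker_eq_bot']
    intro x hx
    rw [Submodule.disjoint_def] at hdisj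
    exact hdisj x (FDMod.mkQ_eq_zero.mp (congrArg Prod.fst hx))
      (FDMod.mkQ_eq_zero.mp (congrArg Prod.snd hx))
  -- The image of `φ` consists of the pairs with equal image in `V`: preimages `x`, `x'` of such a
  -- pair differ by an element `y + y'` of `N + N'`, and `x - y = x' + y'` maps to both classes.
  have hmem : ∀ v, (s.prod s') v ∈ LinearMap.range φ := by
    intro v
    obtain ⟨x, hx⟩ := M.mkQ_surjective N (s v)
    obtain ⟨x', hx'⟩ := M.mkQ_surjective N' (s' v)
    have h1 : g x = v := by
      rw [← FDMod.quotientLift_mkQ g N (hsup ▸ le_sup_left), hx]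
      exact LinearMap.congr_fun hs v
    have h2 : g x' = v := by
      rw [← FDMod.quotientLift_mkQ g N' (hsup ▸ le_sup_right), hx']
      exact LinearMap.congr_fun hs' v
    have h3 : x - x' ∈ N ⊔ N' := by
      rw [hsup, LinearMap.mem_ker, map_sub, h1, h2, sub_self]
    obtain ⟨y, hy, y', hy', hyy⟩ := Submodule.mem_sup.mp h3
    refine ⟨x - y, Prod.ext ?_ ?_⟩
    · change M.mkQ N (x - y) = s v
      rw [map_sub, FDMod.mkQ_eq_zero.mpr hy, sub_zero, hx]
    · change M.mkQ N' (x - y) = s' v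
      have : x - y = x' + y' := by
        rw [sub_eq_iff_eq_add, add_assoc, add_comm y' y, hyy, add_sub_cancel]
      rw [this, map_add, FDMod.mkQ_eq_zero.mpr hy', add_zero, hx']
  let e := LinearEquiv.ofInjective φ hφ
  refine ⟨e.symm.toLinearMap ∘ₗ (s.prod s').codRestrict _ hmem, ?_⟩
  ext v
  have h4 : φ (e.symm ⟨(s.prod s') v, hmem v⟩) = (s.prod s') v :=
    congrArg Subtype.val (e.apply_symm_apply ⟨(s.prod s') v, hmem v⟩)
  have h5 : M.mkQ N (e.symm ⟨(s.prod s') v, hmem v⟩) = s v := congrArg Prod.fst h4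
  change g (e.symm ⟨(s.prod s') v, hmem v⟩) = v
  rw [← FDMod.quotientLift_mkQ g N (hsup ▸ le_sup_left), h5]
  exact LinearMap.congr_fun hs v

theorem IsRightAlmostSplit.quotientLift {M V : FDMod k A} {g : M →ₗ[A] V}
    (hg : IsRightAlmostSplit g) {N : Submodule A M} (hN : N ≤ LinearMap.ker g)
    (h : ¬ IsSplitEpimorphism (FDMod.quotientLift g N hN)) :
    IsRightAlmostSplit (FDMod.quotientLift g N hN) := by
  refine ⟨h, fun Y f hf => ?_⟩
  obtain ⟨f', rfl⟩ := hg.2 Y f hf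
  exact ⟨M.mkQ N ∘ₗ f', rfl⟩

/-- Take a surjective right almost split `g` with source of minimal dimension. Dividing by a nonzero
submodule of the kernel must give a split epimorphism, for otherwise the quotient would be a smaller
example. A decomposition of the kernel into two nonzero parts would then split `g` itself. -/
theorem FDMod.IsIndecomposable.exists_isAuslanderReiten [FiniteDimensional k A] {V : FDMod k A}
    (hV : V.IsIndecomposable) (hP : ¬ Module.Projective A V) :
    ∃ (L M : FDMod k A) (E : SES L M V), E.IsAuslanderReiten := by
  classical
  have hex : ∃ n, ∃ (M : FDMod k A) (g : M →ₗ[A] V), Function.Surjective g ∧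
      IsRightAlmostSplit g ∧ Module.finrank k M = n := by
    obtain ⟨M, g, hs, hg⟩ := hV.exists_isRightAlmostSplit hP
    exact ⟨_, M, g, hs, hg, rfl⟩
  obtain ⟨M, g, hs, hg, hn⟩ := Nat.find_spec hex
  have hmin : ∀ (N : Submodule A M) (hN : N ≤ LinearMap.ker g),
      ¬ IsSplitEpimorphism (FDMod.quotientLift g N hN) → N = ⊥ := by
    intro N hN h
    apply FDMod.eq_bot_of_finrank_le_quotient (k := k)
    rw [hn]
    refine Nat.find_min' hex ⟨_, FDMod.quotientLift g N hN, fun v => ?_, hg.quotientLift hN h, rfl⟩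
    obtain ⟨x, rfl⟩ := hs v
    exact ⟨M.mkQ N x, rfl⟩
  refine ⟨_, M, SES.ofSurjective g hs, hg.1, ⟨?_, fun N N' hc => ?_⟩, hV, hg.2⟩
  · by_contra hnt
    rw [not_nontrivial_iff_subsingleton] at hnt
    have hker : LinearMap.ker g = ⊥ := Submodule.subsingleton_iff_eq_bot.mp hnt
    let e := LinearEquiv.ofBijective g ⟨LinearMap.ker_eq_bot.mp hker, hs⟩
    exact hg.1 ⟨e.symm.toLinearMap, LinearMap.ext e.apply_symm_apply⟩
  · change Submodule A (LinearMap.ker g) at N N'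
    let i := (LinearMap.ker g).subtype
    have hi : Function.Injective i := (LinearMap.ker g).injective_subtype
    have hsup : N.map i ⊔ N'.map i = LinearMap.ker g := by
      rw [← Submodule.map_sup]
      have : N ⊔ N' = ⊤ := hc.sup_eq_top
      rw [this, Submodule.map_top, Submodule.range_subtype]
    have hdisj : Disjoint (N.map i) (N'.map i) := by
      rw [disjoint_iff, ← Submodule.map_inf i hi]
      have : N ⊓ N' = ⊥ := hc.inf_eq_bot
      rw [this, Submodule.map_bot]
    by_contra! hne
    refine hg.1 (isSplitEpimorphism_of_quotients hdisj hsup ?_ ?_)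
    · by_contra h
      exact hne.1 ((Submodule.map_injective_of_injective hi ((hmin _ _ h).trans (Submodule.map_bot i).symm)))
    · by_contra h
      exact hne.2 ((Submodule.map_injective_of_injective hi ((hmin _ _ h).trans (Submodule.map_bot i).symm)))

theorem exists_isARClass [FiniteDimensional k A] (j : Ind k A) : ∃ x, IsARClass j x := by
  by_cases hP : Module.Projective A (indRep j)
  · exact ⟨_, Or.inl ⟨hP, rfl⟩⟩
  · obtain ⟨L, M, E, hE⟩ := (indRep_isIndecomposable j).exists_isAuslanderReiten hP
    exact ⟨_, Or.inr ⟨hP, L, M, E, hE, rfl⟩⟩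

end

theorem mainTheorem10 (k : Type u) (A : Type u) [Field k] [IsAlgClosed k] [Ring A] [Algebra k A]
    [FiniteDimensional k A] [DecidableEq (Ind k A)] :
    -- the elements `X j` exist and are uniquely determined
    ∃ X : Ind k A → GGroup k A, (∀ j x, IsARClass j x ↔ x = X j) ∧
      -- (1)
      (∀ i j, homForm k A (gen i) (X j) = if i = j then 1 else 0) ∧
      (homForm k A).Nondegenerate ∧
      (∀ (B C D : FDMod k A) (E : SES B C D),
        (∀ i, 0 ≤ homForm k A (gen i) E.cls) ∧ ∀ V, 0 ≤ homForm k A (cls V) E.cls) ∧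
      -- (2)
      (∀ (j : Ind k A) (C B : FDMod k A) (Q : SES C B (indRep j)), ¬ Q.IsSplit → Q.cls ≠ X j →
        ∃ i, i ≠ j ∧ 1 ≤ homForm k A (gen i) Q.cls) := by
  choose X hX using exists_isARClass (k := k) (A := A)
  refine ⟨X, fun j x => ⟨fun hx => isARClass_unique hx (hX j), fun hx => hx ▸ hX j⟩,
    fun i j => homForm_gen_of_isARClass (hX j) i,
    ⟨homForm_separatingLeft exists_isARClass, homForm_separatingRight⟩,
    fun B C D E => ⟨E.homForm_gen_cls_nonneg, E.homForm_cls_cls_nonneg⟩,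
    fun j C B Q hQ hne => Q.exists_homForm_gen_cls_pos (hX j) hQ hne⟩
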